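/- Let $p$ be a prime, let $n,s,m$ be positive integers, and let $\mathcal{R}=\mathbb{F}_{p^m}[u]/\langle u^3\rangle$. Let $\alpha_0\in\mathbb{F}_{p^m}\setminus\{0\}$ be such that $x^n-\alpha_0$ is irreducible over $\mathbb{F}_{p^m}$, put $\alpha=\alpha_0^{p^s}$, and let $\gamma\in\mathbb{F}_{p^m}$ (possibly $\gamma=0$). Identify words of length $N=np^s$ with polynomials of degree less than $N$; an $(\alpha+\gamma u^2)$-constacyclic code of length $np^s$ over $\mathcal{R}$ is then an ideal $\mathcal{C}$ of $\mathcal{R}[x]/\langle x^{np^s}-(\alpha+\gamma u^2)\rangle$, and $\mathcal{C}$ is called non-trivial if it is neither the zero ideal nor the whole ring. The Hamming distance $d_H$ of a non-zero code is the least number of non-zero components of a non-zero codeword. Let $\mathrm{Tor}_{u^2}(\mathcal{C})=\{a(x)\in\mathbb{F}_{p^m}[x]/\langle x^{np^s}-\alpha\rangle : u^2a(x)\in\mathcal{C}\}$, which is an ideal, i.e. an $\alpha$-constacyclic code of length $np^s$ over $\mathbb{F}_{p^m}$. Let $\mathcal{C}$ be a non-trivial $(\alpha+\gamma u^2)$-constacyclic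 code of length $np^s$ over $\mathcal{R}$ with $\mathrm{Tor}_{u^2}(\mathcal{C})=\langle (x^n-\alpha_0)^c\rangle$, where $0\le c<p^s$. Then $d_H(\mathcal{C})=d_H(\mathrm{Tor}_{u^2}(\mathcal{C}))$, and $$d_H(\mathcal{C})=\begin{cases}1 & \text{if } c=0;\\ \ell+2 & \text{if } \ell p^{s-1}+1\le c\le(\ell+1)p^{s-1} \text{ with } 0\le\ell\le p-2;\\ (i+1)p^k & \text{if } p^s-p^{s-k}+(i-1)p^{s-k-1}+1\le c\le p^s-p^{s-k}+ip^{s-k-1}\\ & \text{with } 1\le i\le p-1 \text{ and } 1\le k\le s-1.\end{cases}$$ -/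

import Mathlib

open Polynomial

namespace Constacyclic

/-- The ring `A[x]/⟨x^N - lam⟩`, whose ideals are the `lam`-constacyclic codes of length `N`
over `A`. -/
abbrev AmbientRing (A : Type*) [CommRing A] (N : ℕ) (lam : A) : Type _ :=
  AdjoinRoot (X ^ N - C lam : A[X])

/-- The identification `(a_0, …, a_{N-1}) ↦ a_0 + a_1 x + ⋯ + a_{N-1} x^{N-1} + ⟨x^N - lam⟩`
of `A^N` with `A[x]/⟨x^N - lam⟩`. -/
noncomputable def wordClass {A : Type*} [CommRing A] {N : ℕ} {lam : A} (a : Fin N → A) :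
    AmbientRing A N lam :=
  AdjoinRoot.mk _ (∑ i : Fin N, C (a i) * X ^ (i : ℕ))

open Classical in
/-- The Hamming distance of a constacyclic code: the least Hamming weight (number of non-zero
components) of a non-zero codeword, and `0` for the zero code. -/
noncomputable def codeDist {A : Type*} [CommRing A] {N : ℕ} {lam : A}
    (I : Ideal (AmbientRing A N lam)) : ℕ :=
  sInf {w : ℕ | ∃ a : Fin N → A, a ≠ 0 ∧ wordClass a ∈ I ∧ hammingNorm a = w}

/-- The chain ring `F[u]/⟨u^3⟩`. -/
abbrev ChainRing (F : Type*) [Field F] : Type _ := AdjoinRoot (X ^ 3 : F[X])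

/-- The class of `u` in `F[u]/⟨u^3⟩`. -/
noncomputable def u (F : Type*) [Field F] : ChainRing F := AdjoinRoot.root (X ^ 3 : F[X])

/-- The element `α + γ u^2` of `F[u]/⟨u^3⟩`. -/
noncomputable def shiftConst {F : Type*} [Field F] (α γ : F) : ChainRing F :=
  AdjoinRoot.of (X ^ 3 : F[X]) α + AdjoinRoot.of (X ^ 3 : F[X]) γ * u F ^ 2

/-- For a polynomial `f` over `F`, the element `u^2 f(x)` of
`(F[u]/⟨u^3⟩)[x]/⟨x^N - (α + γ u^2)⟩`. -/
noncomputable def uSqMul {F : Type*} [Field F] (N : ℕ) (α γ : F) (f : F[X]) :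
    AmbientRing (ChainRing F) N (shiftConst α γ) :=
  AdjoinRoot.mk _ (C (u F ^ 2) * f.map (AdjoinRoot.of (X ^ 3 : F[X])))

/-- `Tor_{u^2}(I)`: the ideal of those `a` in `F[x]/⟨x^N - α⟩` with `u^2 a(x) ∈ I`. The choice of
the representative of `a` in `F[x]` does not matter, see `mk_mem_torUSq`. -/
noncomputable def torUSq {F : Type*} [Field F] {N : ℕ} {α γ : F}
    (I : Ideal (AmbientRing (ChainRing F) N (shiftConst α γ))) :
    Ideal (AmbientRing F N α) where
  carrier := {a | ∃ f : F[X], AdjoinRoot.mk _ f = a ∧ uSqMul N α γ f ∈ I}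
  zero_mem' := ⟨0, by simp, by simp [uSqMul]⟩
  add_mem' := by
    rintro _ _ ⟨f, rfl, hf⟩ ⟨g, rfl, hg⟩
    refine ⟨f + g, by simp, ?_⟩
    have h := I.add_mem hf hg
    simpa [uSqMul, mul_add] using h
  smul_mem' := by
    rintro r _ ⟨f, rfl, hf⟩
    obtain ⟨g, rfl⟩ := AdjoinRoot.mk_surjective r
    refine ⟨g * f, by simp, ?_⟩
    have h := I.mul_mem_left
      (AdjoinRoot.mk _ (g.map (AdjoinRoot.of (X ^ 3 : F[X])))) hf
    have e : uSqMul N α γ (g * f) =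
        AdjoinRoot.mk _ (g.map (AdjoinRoot.of (X ^ 3 : F[X]))) * uSqMul N α γ f := by
      simp only [uSqMul, ← map_mul, Polynomial.map_mul]
      congr 1
      ring
    rw [e]
    exact h

theorem u_pow_three (F : Type*) [Field F] : u F ^ 3 = 0 := by
  have h := AdjoinRoot.mk_self (f := (X ^ 3 : F[X]))
  simpa [u, map_pow] using h

/-- `u^2 (x^N - α) = 0` in the ambient ring, so `u^2 f(x)` depends only on `f` modulo
`x^N - α`. -/
theorem uSqMul_eq_of_mk_eq {F : Type*} [Field F] {N : ℕ} {α γ : F} {f g : F[X]}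
    (h : AdjoinRoot.mk (X ^ N - C α : F[X]) f = AdjoinRoot.mk (X ^ N - C α : F[X]) g) :
    uSqMul N α γ f = uSqMul N α γ g := by
  obtain ⟨q, hq⟩ := AdjoinRoot.mk_eq_mk.1 h
  refine AdjoinRoot.mk_eq_mk.2 ?_
  refine ⟨C (u F ^ 2) * q.map (AdjoinRoot.of (X ^ 3 : F[X])), ?_⟩
  have hf : f = g + (X ^ N - C α) * q := by rw [← hq]; ring
  have h4 : u F ^ 2 * u F ^ 2 = 0 := by
    have : u F ^ 2 * u F ^ 2 = u F ^ 3 * u F := by ring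
    rw [this, u_pow_three, zero_mul]
  have h5 : (C (u F ^ 2) * C (u F ^ 2) : (ChainRing F)[X]) = 0 := by
    rw [← C_mul, h4, C_0]
  rw [hf]
  simp only [shiftConst, Polynomial.map_add, Polynomial.map_mul, Polynomial.map_sub,
    Polynomial.map_pow, Polynomial.map_X, Polynomial.map_C, C_add, C_mul]
  linear_combination (C (AdjoinRoot.of (X ^ 3 : F[X]) γ) *
    q.map (AdjoinRoot.of (X ^ 3 : F[X]))) * h5

theorem mk_mem_torUSq {F : Type*} [Field F] {N : ℕ} {α γ : F}
    (I : Ideal (AmbientRing (ChainRing F) N (shiftConst α γ))) (f : F[X]) :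
    AdjoinRoot.mk (X ^ N - C α : F[X]) f ∈ torUSq I ↔ uSqMul N α γ f ∈ I := by
  constructor
  · rintro ⟨g, hg, hI⟩
    rwa [uSqMul_eq_of_mk_eq hg.symm]
  · exact fun h => ⟨f, rfl, h⟩

end Constacyclic

/-! A suitable power of `u` turns a non-zero codeword into `u^2` times a non-zero word over `F`
without enlarging its support, so the code and its torsion code have the same distance
(`codeDist_eq_codeDist_torUSq`).

By Frobenius, the torsion code consists of the multiples of `(X^n - α₀)^c` modulo `(X^n -
α₀)^(p^s)`. The key bound is `digitProd_le_card_support`: a root `a ≠ 0` of exact multiplicity `t`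
forces at least as many terms as the product of `d + 1` over the base-`p` digits `d` of `t`.
Splitting exponents modulo `n` brings `X^n - α₀` down to `X - α₀`, so for `c > 0` it remains to
minimise this product over `c ≤ t < p^s`. The minimum is the value at the right end `T` of the
interval containing `c` (`le_digitProd`), and `(X^n - α₀)^T` attains it (`card_support_pow_le`). -/

namespace Constacyclic

/-! ### Digit products in base `p`. -/

/-- The product of `d + 1` over the base-`p` digits `d` of `t`. -/
def digitProd (p t : ℕ) : ℕ := ((p.digits t).map (· + 1)).prod

theorem digitProd_zero (p : ℕ) : digitProd p 0 = 1 := by simp [digitProd]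

theorem digitProd_add_mul {p : ℕ} (hp : 2 ≤ p) (a : ℕ) {e : ℕ} (he : e < p) :
    digitProd p (e + p * a) = (e + 1) * digitProd p a := by
  by_cases h : e = 0 ∧ a = 0
  · obtain ⟨rfl, rfl⟩ := h
    simp [digitProd]
  · rw [digitProd, Nat.digits_add p (by omega) e a he (by tauto)]
    simp [digitProd]

theorem digitProd_pos (p t : ℕ) : 0 < digitProd p t :=
  List.prod_pos (by simp)

theorem two_le_digitProd {p : ℕ} (hp : 2 ≤ p) {t : ℕ} (ht : 0 < t) : 2 ≤ digitProd p t := by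
  induction t using Nat.strong_induction_on with
  | _ t ih =>
    rw [← Nat.mod_add_div t p, digitProd_add_mul hp _ (Nat.mod_lt _ (by omega))]
    by_cases h : t % p = 0
    · have h1 := Nat.mod_add_div t p
      have h2 : 0 < t / p := Nat.pos_of_ne_zero fun h0 => by rw [h, h0] at h1; omega
      rw [h, zero_add, one_mul]
      exact ih _ (Nat.div_lt_self ht (by omega)) h2
    · have := digitProd_pos p (t / p)
      nlinarith [Nat.pos_of_ne_zero h]

theorem digitProd_add_pow_mul {p : ℕ} (hp : 2 ≤ p) (a j : ℕ) {b : ℕ} (hb : b < p ^ j) :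
    digitProd p (b + p ^ j * a) = digitProd p b * digitProd p a := by
  induction j generalizing b with
  | zero =>
    obtain rfl : b = 0 := by simpa using hb
    simp [digitProd_zero]
  | succ j ih =>
    have h1 : b / p < p ^ j := Nat.div_lt_of_lt_mul (by rwa [pow_succ'] at hb)
    have h2 : b % p < p := Nat.mod_lt _ (by omega)
    have h3 := Nat.mod_add_div b p
    have h4 : b + p ^ (j + 1) * a = b % p + p * (b / p + p ^ j * a) := by
      conv_lhs => rw [← h3]
      ring
    rw [h4, digitProd_add_mul hp _ h2, ih h1, ← mul_assoc, ← digitProd_add_mul hp _ h2, h3]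

theorem digitProd_pow_sub_one {p : ℕ} (hp : 2 ≤ p) (k : ℕ) : digitProd p (p ^ k - 1) = p ^ k := by
  induction k with
  | zero => simp [digitProd_zero]
  | succ k ih =>
    have h1 : p ^ (k + 1) - 1 = (p - 1) + p * (p ^ k - 1) := by
      have : 1 ≤ p ^ k := Nat.one_le_pow _ _ (by omega)
      obtain ⟨q, hq⟩ := Nat.exists_eq_add_of_le this
      rw [pow_succ', hq, mul_add, Nat.add_sub_cancel_left]
      omega
    rw [h1, digitProd_add_mul hp _ (by omega), ih, Nat.sub_add_cancel (by omega), pow_succ']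

/-- The digit product is at least `(i + 2) * p ^ k` for each `t < p ^ (j + k + 1)` greater than
`p ^ j * (p ^ (k + 1) - p + i)`. -/
theorem le_digitProd {p : ℕ} (hp : 2 ≤ p) {i j k t : ℕ} (hi : i + 1 < p)
    (ht : p ^ j * (i + p * (p ^ k - 1)) + 1 ≤ t) (ht' : t < p ^ j * p ^ (k + 1)) :
    (i + 2) * p ^ k ≤ digitProd p t := by
  have hq : 0 < p ^ j := by positivity
  have h1 := Nat.mod_add_div t (p ^ j)
  have h2 : t % p ^ j < p ^ j := Nat.mod_lt _ hq
  have h3 : t / p ^ j < p ^ (k + 1) := Nat.div_lt_of_lt_mul ht'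
  have h4 : i + p * (p ^ k - 1) ≤ t / p ^ j := by
    rw [Nat.le_div_iff_mul_le hq, mul_comm]
    omega
  rw [← h1, digitProd_add_pow_mul hp _ _ h2]
  -- If `t / p^j` equals the bound, the low digits are not all zero and contribute a factor at least
  -- 2, while `2(i + 1) ≥ i + 2`. Otherwise `t / p^j < p^(k+1)` keeps its top `k` digits at `p - 1`
  -- and raises the last one above `i`.
  rcases h4.eq_or_lt with h5 | h5
  · have h6 : 0 < t % p ^ j := by
      rw [← h5] at h1
      omega
    rw [← h5, digitProd_add_mul hp _ (by omega), digitProd_pow_sub_one hp]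
    have := two_le_digitProd hp h6
    calc (i + 2) * p ^ k ≤ 2 * ((i + 1) * p ^ k) := by nlinarith [Nat.zero_le (i * p ^ k)]
      _ ≤ _ := Nat.mul_le_mul_right _ this
  · obtain ⟨e, he⟩ := Nat.exists_eq_add_of_lt h5
    have h7 : 1 ≤ p ^ k := Nat.one_le_pow _ _ (by omega)
    have h8 : p * (p ^ k - 1) + p = p ^ (k + 1) := by
      rw [Nat.mul_sub, mul_one, Nat.sub_add_cancel (Nat.le_mul_of_pos_right _ h7), pow_succ']
    have h9 : t / p ^ j = (i + e + 1) + p * (p ^ k - 1) := by omega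
    rw [h9, digitProd_add_mul hp _ (by omega), digitProd_pow_sub_one hp]
    have := digitProd_pos p (t % p ^ j)
    calc (i + 2) * p ^ k ≤ (i + e + 1 + 1) * p ^ k := Nat.mul_le_mul_right _ (by omega)
      _ ≤ _ := Nat.le_mul_of_pos_left _ this

/-! ### Root multiplicity and number of terms. -/

section Sections

variable {F : Type*} [Field F]

/-- The polynomial whose coefficients are those of `f` at the indices `m * j + r`. -/
noncomputable def residueSection (m r : ℕ) (f : F[X]) : F[X] :=
  ∑ j ∈ Finset.range (f.natDegree + 1), monomial j (f.coeff (m * j + r))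

theorem coeff_residueSection {m : ℕ} (hm : 0 < m) (r : ℕ) (f : F[X]) (j : ℕ) :
    (residueSection m r f).coeff j = f.coeff (m * j + r) := by
  simp only [residueSection, finsetSum_coeff, coeff_monomial, Finset.sum_ite_eq',
    Finset.mem_range]
  split_ifs with h
  · rfl
  · refine (coeff_eq_zero_of_natDegree_lt ?_).symm
    nlinarith

theorem residueSection_add {m : ℕ} (hm : 0 < m) (r : ℕ) (f g : F[X]) :
    residueSection m r (f + g) = residueSection m r f + residueSection m r g := by
  ext j
  simp [coeff_residueSection hm]

/-- Multiplying by a polynomial in `X^m` preserves the residue of each exponent modulo `m`. -/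
theorem residueSection_expand_mul {m r : ℕ} (hr : r < m) (h f : F[X]) :
    residueSection m r (expand F m h * f) = h * residueSection m r f := by
  have hm : 0 < m := by omega
  induction h using Polynomial.induction_on' with
  | add g h hg hh => rw [map_add, add_mul, residueSection_add hm, hg, hh, add_mul]
  | monomial k a =>
    ext j
    rw [coeff_residueSection hm, expand_monomial, ← C_mul_X_pow_eq_monomial,
      ← C_mul_X_pow_eq_monomial, mul_assoc, mul_assoc, coeff_C_mul, coeff_C_mul,
      coeff_X_pow_mul', coeff_X_pow_mul', coeff_residueSection hm]
    by_cases hk : k ≤ j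
    · obtain ⟨i, rfl⟩ := Nat.exists_eq_add_of_le hk
      have h1 : m * (k + i) + r = k * m + (m * i + r) := by ring
      rw [h1, if_pos (by omega), if_pos hk]
      simp
    · have : m * j + r < k * m := by nlinarith
      rw [if_neg (by omega), if_neg hk]

theorem sum_X_pow_mul_expand_residueSection {m : ℕ} (hm : 0 < m) (f : F[X]) :
    ∑ r ∈ Finset.range m, X ^ r * expand F m (residueSection m r f) = f := by
  ext d
  rw [finsetSum_coeff, Finset.sum_eq_single (d % m)]
  · rw [coeff_X_pow_mul', if_pos (Nat.mod_le _ _), coeff_expand hm, if_pos (Nat.dvd_sub_mod d),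
      coeff_residueSection hm, Nat.mul_div_cancel' (Nat.dvd_sub_mod d),
      Nat.sub_add_cancel (Nat.mod_le _ _)]
  · intro r hr hrd
    rw [coeff_X_pow_mul']
    split_ifs with h
    · rw [coeff_expand hm, if_neg]
      rintro ⟨k, hk⟩
      apply hrd
      obtain rfl : d = r + m * k := by omega
      rw [Nat.add_mul_mod_self_left, Nat.mod_eq_of_lt (Finset.mem_range.1 hr)]
    · rfl
  · intro h
    exact absurd (Finset.mem_range.2 (Nat.mod_lt _ hm)) h

theorem sum_card_support_residueSection_le {m : ℕ} (hm : 0 < m) (f : F[X]) (S : Finset ℕ)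
    (hS : S ⊆ Finset.range m) :
    ∑ r ∈ S, (residueSection m r f).support.card ≤ f.support.card := by
  have hinj : ∀ r, Function.Injective fun j => m * j + r := fun r i j h => by
    have : m * i = m * j := by simpa using h
    exact Nat.eq_of_mul_eq_mul_left hm this
  have h1 : ∀ r ∈ S, ∀ j, (m * j + r) % m = r := fun r hr j => by
    rw [Nat.mul_add_mod, Nat.mod_eq_of_lt (Finset.mem_range.1 (hS hr))]
  calc ∑ r ∈ S, (residueSection m r f).support.card
      = ∑ r ∈ S, ((residueSection m r f).support.image fun j => m * j + r).card :=
        Finset.sum_congr rfl fun r _ => (Finset.card_image_of_injective _ (hinj r)).symm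
    _ = (S.biUnion fun r => (residueSection m r f).support.image fun j => m * j + r).card := by
        refine (Finset.card_biUnion fun r hr r' hr' hne => ?_).symm
        refine Finset.disjoint_left.2 fun d hd hd' => ?_
        obtain ⟨j, -, rfl⟩ := Finset.mem_image.1 hd
        obtain ⟨j', -, hj'⟩ := Finset.mem_image.1 hd'
        apply hne
        rw [← h1 r hr j, ← h1 r' hr' j', hj']
    _ ≤ f.support.card := by
        refine Finset.card_le_card fun d hd => ?_
        obtain ⟨r, -, hd⟩ := Finset.mem_biUnion.1 hd
        obtain ⟨j, hj, rfl⟩ := Finset.mem_image.1 hd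
        rwa [mem_support_iff, coeff_residueSection hm, ← mem_support_iff] at hj

theorem isCoprime_X_sub_C_X {a : F} (ha : a ≠ 0) : IsCoprime (X - C a) X := by
  simpa using isCoprime_X_sub_C_of_isUnit_sub (R := F) (a := a) (b := 0) (by simpa using ha)

theorem card_support_X_mul (f : F[X]) : (X * f).support.card = f.support.card := by
  refine (Finset.card_bij (fun d _ => d + 1) ?_ ?_ ?_).symm
  · intro d hd
    simpa [mul_comm X] using hd
  · intro a _ b _ h
    simpa using h
  · rintro (_ | d) hd
    · simp at hd
    · exact ⟨d, by simpa [mul_comm X] using hd, rfl⟩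

/-- In degree less than the characteristic, the multiplicity of a non-zero root is less than the
number of terms. -/
theorem lt_card_support_of_pow_dvd {p : ℕ} [CharP F p] {a : F} (ha : a ≠ 0) {f : F[X]}
    (hf : f ≠ 0) (hdeg : f.natDegree < p) {e : ℕ} (h : (X - C a) ^ e ∣ f) :
    e < f.support.card := by
  induction hd : f.natDegree using Nat.strong_induction_on generalizing f e with
  | _ d ih =>
    -- A factor `X` is coprime to `X - a` and can be removed. Otherwise differentiation kills the
    -- constant term and costs at most one in multiplicity.
    by_cases h0 : f.coeff 0 = 0
    · obtain ⟨g, rfl⟩ := X_dvd_iff.2 h0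
      have hg : g ≠ 0 := right_ne_zero_of_mul hf
      have hgd := natDegree_X_mul hg
      rw [card_support_X_mul]
      exact ih g.natDegree (by omega) hg (by omega)
        (((isCoprime_X_sub_C_X ha).pow_left).dvd_of_dvd_mul_left h) rfl
    · have hs : 0 ∈ f.support := mem_support_iff.2 h0
      rcases e with _ | e
      · exact Finset.card_pos.2 ⟨0, hs⟩
      have hd0 : f.natDegree ≠ 0 := by
        intro hd0
        have := (natDegree_le_of_dvd h hf)
        rw [natDegree_pow, natDegree_X_sub_C] at this
        omega
      have hcast : ∀ k : ℕ, k + 1 < p → ((k : F) + 1) ≠ 0 := fun k hk h => by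
        have h' : ((k + 1 : ℕ) : F) = 0 := by exact_mod_cast h
        exact absurd (Nat.le_of_dvd (by omega) ((CharP.cast_eq_zero_iff F p _).1 h')) (by omega)
      have hder : derivative f ≠ 0 := by
        intro h0
        have h1 : (derivative f).coeff (f.natDegree - 1) = 0 := by rw [h0, coeff_zero]
        rw [coeff_derivative, Nat.sub_add_cancel (by omega)] at h1
        rcases mul_eq_zero.1 h1 with h2 | h2
        · exact hf (leadingCoeff_eq_zero.1 h2)
        · exact hcast _ (by omega) h2
      have hlt := natDegree_derivative_lt hd0
      have hdvd : (X - C a) ^ e ∣ derivative f := by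
        simpa using pow_sub_one_dvd_derivative_of_pow_dvd h
      have h1 := ih _ (by omega) hder (by omega) hdvd rfl
      have h2 : (derivative f).support.card ≤ (f.support.erase 0).card := by
        refine Finset.card_le_card_of_injOn (· + 1) (fun k hk => ?_)
          (fun a _ b _ h => by simpa using h)
        have hk' : (derivative f).coeff k ≠ 0 := mem_support_iff.1 hk
        rw [coeff_derivative] at hk'
        simpa using left_ne_zero_of_mul hk'
      rw [Finset.card_erase_of_mem hs] at h2
      omega

/-- With `t = e + pμ`, write `f = (X^p - a^p)^μ g`. Modulo `(X - a)^p`, `g` reduces to a polynomial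
`k` of degree below `p` with more than `e` terms. Each of these terms marks a section of `f` in
which `a^p` has multiplicity exactly `μ`, and induction applies to it. -/
theorem digitProd_le_card_support {p : ℕ} (hp : p.Prime) [CharP F p] {a : F} (ha : a ≠ 0)
    {f : F[X]} {t : ℕ} (h : (X - C a) ^ t ∣ f) (h' : ¬ (X - C a) ^ (t + 1) ∣ f) :
    digitProd p t ≤ f.support.card := by
  have hp2 := hp.two_le
  have : Fact p.Prime := ⟨hp⟩
  induction t using Nat.strong_induction_on generalizing a f with
  | _ t ih =>
    rcases Nat.eq_zero_or_pos t with rfl | ht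
    · rw [digitProd_zero, Nat.succ_le_iff, Finset.card_pos, support_nonempty]
      rintro rfl
      exact h' (dvd_zero _)
    have hpos := hp.pos
    have ht' := Nat.mod_add_div t p
    set e := t % p
    set μ := t / p
    have he : e < p := Nat.mod_lt _ hpos
    have hμ : μ < t := Nat.div_lt_self ht hp2
    have hfrob : (X - C a) ^ p = expand F p (X - C (a ^ p)) := by
      rw [sub_pow_char, map_sub, expand_X, expand_C, C_pow]
    have hpow : (X - C a) ^ (p * μ) = expand F p ((X - C (a ^ p)) ^ μ) := by
      rw [pow_mul, hfrob, ← map_pow]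
    have hne : (X - C a) ^ (p * μ) ≠ 0 := pow_ne_zero _ (X_sub_C_ne_zero a)
    obtain ⟨g, rfl⟩ : (X - C a) ^ (p * μ) ∣ f := (pow_dvd_pow _ (by omega)).trans h
    have hg : (X - C a) ^ e ∣ g := by
      rwa [← ht', add_comm e, pow_add, mul_dvd_mul_iff_left hne] at h
    have hg' : ¬ (X - C a) ^ (e + 1) ∣ g := by
      rwa [← ht', add_comm e, add_assoc, pow_add, mul_dvd_mul_iff_left hne] at h'
    set w : ℕ → F := fun r => (residueSection p r g).eval (a ^ p)
    set k : F[X] := ∑ r ∈ Finset.range p, C (w r) * X ^ r with hk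
    have hcoeff : ∀ d, k.coeff d = if d < p then w d else 0 := by
      intro d
      simp [hk, finsetSum_coeff, coeff_C_mul, coeff_X_pow]
    -- Replacing each section by its value at `a^p` changes `g` by a multiple of `X^p - a^p = (X -
    -- a)^p`.
    have hgk : (X - C a) ^ p ∣ g - k := by
      conv_rhs => rw [← sum_X_pow_mul_expand_residueSection hpos g]
      rw [hk, ← Finset.sum_sub_distrib]
      refine Finset.dvd_sum fun r _ => ?_
      obtain ⟨q, hq⟩ := X_sub_C_dvd_sub_C_eval (a := a ^ p) (p := residueSection p r g)
      refine ⟨X ^ r * expand F p q, ?_⟩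
      have := congrArg (expand F p) hq
      rw [map_sub, map_mul, ← hfrob, expand_C] at this
      linear_combination X ^ r * this
    have hke : (X - C a) ^ e ∣ k :=
      (dvd_sub_right hg).1 ((pow_dvd_pow _ he.le).trans hgk)
    have hk0 : k ≠ 0 := by
      intro h0
      rw [h0, sub_zero] at hgk
      exact hg' ((pow_dvd_pow _ he).trans hgk)
    have hkdeg : k.natDegree < p := by
      rw [natDegree_lt_iff_degree_lt hk0, degree_lt_iff_coeff_zero]
      intro d hd
      rw [hcoeff, if_neg (by omega)]
    have hcard := lt_card_support_of_pow_dvd ha hk0 hkdeg hke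
    have hsub : k.support ⊆ Finset.range p := by
      intro d hd
      rw [mem_support_iff, hcoeff] at hd
      by_contra hc
      exact hd (if_neg (by simpa using hc))
    have hsec : ∀ r ∈ k.support,
        digitProd p μ ≤ (residueSection p r ((X - C a) ^ (p * μ) * g)).support.card := by
      intro r hr
      have hrp := Finset.mem_range.1 (hsub hr)
      rw [mem_support_iff, hcoeff, if_pos hrp] at hr
      rw [hpow, residueSection_expand_mul hrp]
      refine ih μ hμ (pow_ne_zero p ha) (dvd_mul_right _ _) ?_
      rw [pow_succ, mul_dvd_mul_iff_left (pow_ne_zero _ (X_sub_C_ne_zero _)), dvd_iff_isRoot]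
      exact hr
    calc digitProd p t = (e + 1) * digitProd p μ := by
          rw [← digitProd_add_mul hp2 _ he, ht']
      _ ≤ k.support.card * digitProd p μ := Nat.mul_le_mul_right _ hcard
      _ = ∑ _r ∈ k.support, digitProd p μ := by simp
      _ ≤ _ := Finset.sum_le_sum hsec
      _ ≤ _ := sum_card_support_residueSection_le hpos _ _ hsub

/-- The Hamming weight of a non-zero multiple of `(x^n - a)^c` of degree less than `n p^s` is at
least the digit product of some `t` with `c ≤ t < p^s`. -/
theorem exists_digitProd_le_card_support {p : ℕ} (hp : p.Prime) [CharP F p] {a : F} (ha : a ≠ 0)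
    {n s c : ℕ} (hn : 0 < n) {f : F[X]} (hf : f ≠ 0) (hdeg : ∀ d, n * p ^ s ≤ d → f.coeff d = 0)
    (h : (X ^ n - C a) ^ c ∣ f) :
    ∃ t, c ≤ t ∧ t < p ^ s ∧ digitProd p t ≤ f.support.card := by
  obtain ⟨r, hr, hr0⟩ : ∃ r < n, residueSection n r f ≠ 0 := by
    by_contra! hc
    apply hf
    rw [← sum_X_pow_mul_expand_residueSection hn f]
    exact Finset.sum_eq_zero fun r hr => by rw [hc r (Finset.mem_range.1 hr)]; simp
  set g := residueSection n r f
  have hcg : (X - C a) ^ c ∣ g := by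
    obtain ⟨q, rfl⟩ := h
    refine ⟨residueSection n r q, ?_⟩
    rw [← residueSection_expand_mul hr]
    simp [g]
  have hgdeg : g.natDegree < p ^ s := by
    rw [natDegree_lt_iff_degree_lt hr0, degree_lt_iff_coeff_zero]
    intro d hd
    rw [coeff_residueSection hn]
    exact hdeg _ (by nlinarith)
  refine ⟨g.rootMultiplicity a, (le_rootMultiplicity_iff hr0).2 hcg, ?_, ?_⟩
  · have := natDegree_le_of_dvd (pow_rootMultiplicity_dvd g a) hr0
    rw [natDegree_pow, natDegree_X_sub_C] at this
    omega
  · refine (digitProd_le_card_support hp ha (pow_rootMultiplicity_dvd g a)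
      (pow_rootMultiplicity_not_dvd hr0 a)).trans ?_
    simpa using sum_card_support_residueSection_le hn f {r} (by simpa using hr)

theorem card_support_expand {m : ℕ} (hm : 0 < m) (f : F[X]) :
    (expand F m f).support.card = f.support.card := by
  refine (Finset.card_bij (fun d _ => d * m) ?_ ?_ ?_).symm
  · intro d hd
    rw [mem_support_iff] at hd ⊢
    rwa [coeff_expand_mul hm]
  · intro a _ b _ h
    exact Nat.eq_of_mul_eq_mul_right hm h
  · intro d hd
    rw [mem_support_iff, coeff_expand hm] at hd
    by_cases hmd : m ∣ d
    · rw [if_pos hmd] at hd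
      exact ⟨d / m, mem_support_iff.2 hd, Nat.div_mul_cancel hmd⟩
    · exact absurd (if_neg hmd) hd

/-- Frobenius turns `p`-power exponents into expansions, which keep the number of terms. The
remaining factors have degrees `i` and `p^k - 1`. -/
theorem card_support_pow_le {p : ℕ} (hp : p.Prime) [CharP F p] (a : F) {n : ℕ} (hn : 0 < n)
    (i j k : ℕ) :
    ((X ^ n - C a) ^ (p ^ j * (i + p * (p ^ k - 1))) : F[X]).support.card ≤ (i + 1) * p ^ k := by
  have : Fact p.Prime := ⟨hp⟩
  have hfrob : ∀ (b : F) (l : ℕ), (X - C b) ^ p ^ l = expand F (p ^ l) (X - C (b ^ p ^ l)) := by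
    intro b l
    rw [sub_pow_char_pow, map_sub, expand_X, expand_C, C_pow]
  have hlin : ∀ (b : F) (l : ℕ), ((X - C b) ^ l).support.card ≤ l + 1 := by
    intro b l
    refine (card_supp_le_succ_natDegree _).trans_eq ?_
    rw [natDegree_pow, natDegree_X_sub_C, mul_one]
  have h1 : (X ^ n - C a : F[X]) = expand F n (X - C a) := by simp
  rw [h1, ← map_pow, card_support_expand hn, pow_mul, hfrob, ← map_pow,
    card_support_expand (pow_pos hp.pos j), pow_add, pow_mul]
  have h2 := hfrob (a ^ p ^ j) 1
  rw [pow_one] at h2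
  rw [h2, ← map_pow]
  refine card_support_mul_le.trans (Nat.mul_le_mul (hlin _ _) ?_)
  rw [card_support_expand hp.pos]
  have := hlin ((a ^ p ^ j) ^ p) (p ^ k - 1)
  rwa [Nat.sub_add_cancel (Nat.one_le_pow _ _ hp.pos)] at this

end Sections

end Constacyclic

/-! ### Words as polynomials of bounded degree. -/

namespace Constacyclic

section Words

variable {A : Type*} [CommRing A] {N : ℕ}

theorem coeff_sum_C_mul_X_pow (a : Fin N → A) (d : ℕ) :
    (∑ i : Fin N, C (a i) * X ^ (i : ℕ)).coeff d = if h : d < N then a ⟨d, h⟩ else 0 := by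
  simp only [finsetSum_coeff, coeff_C_mul, coeff_X_pow, mul_ite, mul_one, mul_zero]
  split_ifs with h
  · rw [Finset.sum_eq_single ⟨d, h⟩]
    · simp
    · intro i _ hi
      exact if_neg fun hd => hi (Fin.ext hd.symm)
    · simp
  · exact Finset.sum_eq_zero fun i _ => if_neg (by omega)

theorem sum_C_mul_X_pow_ne_zero {a : Fin N → A} (ha : a ≠ 0) :
    ∑ i : Fin N, C (a i) * X ^ (i : ℕ) ≠ 0 := by
  intro h
  apply ha
  ext i
  have := coeff_sum_C_mul_X_pow a i
  rw [h] at this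
  simpa using this.symm

theorem sum_C_coeff_mul_X_pow {f : A[X]} (hf : ∀ d, N ≤ d → f.coeff d = 0) :
    ∑ i : Fin N, C (f.coeff i) * X ^ (i : ℕ) = f := by
  ext d
  rw [coeff_sum_C_mul_X_pow (fun i : Fin N => f.coeff i)]
  split_ifs with h
  · rfl
  · exact (hf d (by omega)).symm

open Classical in
theorem card_support_sum_C_mul_X_pow (a : Fin N → A) :
    (∑ i : Fin N, C (a i) * X ^ (i : ℕ)).support.card = hammingNorm a := by
  refine (Finset.card_bij (fun (i : Fin N) _ => (i : ℕ)) ?_ ?_ ?_).symm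
  · intro i hi
    rw [mem_support_iff, coeff_sum_C_mul_X_pow]
    simpa using hi
  · intro i _ j _ h
    exact Fin.ext h
  · intro d hd
    rw [mem_support_iff, coeff_sum_C_mul_X_pow] at hd
    by_cases h : d < N
    · rw [dif_pos h] at hd
      exact ⟨⟨d, h⟩, by simpa using hd, rfl⟩
    · exact absurd (dif_neg h) hd

theorem wordClass_mul {lam : A} (r : A) (a : Fin N → A) :
    (wordClass (fun i => r * a i) : AmbientRing A N lam) =
      AdjoinRoot.mk _ (C r) * wordClass a := by
  simp only [wordClass, C_mul, mul_assoc, ← Finset.mul_sum]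
  exact map_mul _ _ _

theorem codeDist_le_card_support {lam : A} {I : Ideal (AmbientRing A N lam)} {f : A[X]}
    (hf : f ≠ 0) (hdeg : ∀ d, N ≤ d → f.coeff d = 0) (hI : AdjoinRoot.mk _ f ∈ I) :
    codeDist I ≤ f.support.card := by
  have h := sum_C_coeff_mul_X_pow hdeg
  refine Nat.sInf_le ⟨fun i => f.coeff i, fun h0 => hf ?_, ?_, ?_⟩
  · rw [← h]
    exact Finset.sum_eq_zero fun i _ => by
      rw [show f.coeff i = 0 from congrFun h0 i, C_0, zero_mul]
  · rwa [wordClass, h]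
  · rw [← card_support_sum_C_mul_X_pow, h]

/-- The codeword `f` ensures that the infimum is not over the empty set, where it would be 0. -/
theorem le_codeDist {lam : A} {I : Ideal (AmbientRing A N lam)} {f : A[X]}
    (hf : f ≠ 0) (hdeg : ∀ d, N ≤ d → f.coeff d = 0) (hI : AdjoinRoot.mk _ f ∈ I) {w : ℕ}
    (hw : ∀ g : A[X], g ≠ 0 → (∀ d, N ≤ d → g.coeff d = 0) → AdjoinRoot.mk _ g ∈ I →
      w ≤ g.support.card) :
    w ≤ codeDist I := by
  have h := sum_C_coeff_mul_X_pow hdeg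
  refine le_csInf ⟨_, fun i => f.coeff i, fun h0 => hf ?_, ?_, rfl⟩ ?_
  · rw [← h]
    exact Finset.sum_eq_zero fun i _ => by
      rw [show f.coeff i = 0 from congrFun h0 i, C_0, zero_mul]
  · rwa [wordClass, h]
  · rintro _ ⟨a, ha, haI, rfl⟩
    rw [← card_support_sum_C_mul_X_pow]
    refine hw _ (sum_C_mul_X_pow_ne_zero ha) (fun d hd => ?_) haI
    rw [coeff_sum_C_mul_X_pow, dif_neg (by omega)]

end Words

/-! ### Reduction to the torsion code. -/

section Torsion

variable {F : Type*} [Field F]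

/-- If `X^3` divides `X g` then `g = X^2 q`, and only the constant term of `q` survives modulo
`X^3`. -/
theorem exists_eq_u_sq_mul_of {r : ChainRing F} (h : u F * r = 0) :
    ∃ x : F, r = u F ^ 2 * AdjoinRoot.of _ x := by
  obtain ⟨g, rfl⟩ := AdjoinRoot.mk_surjective r
  rw [u, ← AdjoinRoot.mk_X, ← map_mul, AdjoinRoot.mk_eq_zero, pow_succ',
    mul_dvd_mul_iff_left X_ne_zero] at h
  obtain ⟨q, rfl⟩ := h
  refine ⟨q.coeff 0, ?_⟩
  rw [u, ← AdjoinRoot.mk_X, ← AdjoinRoot.mk_C, ← map_pow, ← map_mul, AdjoinRoot.mk_eq_mk,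
    ← mul_sub, pow_succ (X : F[X]) 2]
  exact mul_dvd_mul_left _ (X_dvd_iff.2 (by simp))

theorem u_sq_mul_of_eq_zero {x : F} : u F ^ 2 * AdjoinRoot.of _ x = 0 ↔ x = 0 := by
  refine ⟨fun h => ?_, fun h => by simp [h]⟩
  rw [u, ← AdjoinRoot.mk_X, ← AdjoinRoot.mk_C, ← map_pow, ← map_mul, AdjoinRoot.mk_eq_zero,
    pow_succ (X : F[X]) 2, mul_dvd_mul_iff_left (pow_ne_zero _ X_ne_zero), X_dvd_iff] at h
  simpa using h

variable {N : ℕ} {α γ : F}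

theorem wordClass_u_sq_mul_of (v : Fin N → F) :
    (wordClass (fun i => u F ^ 2 * AdjoinRoot.of _ (v i)) :
      AmbientRing (ChainRing F) N (shiftConst α γ)) =
    uSqMul N α γ (∑ i : Fin N, C (v i) * X ^ (i : ℕ)) := by
  simp [wordClass, uSqMul, Polynomial.map_sum, Finset.mul_sum, mul_assoc]

theorem wordClass_mem_torUSq (I : Ideal (AmbientRing (ChainRing F) N (shiftConst α γ)))
    (v : Fin N → F) :
    wordClass v ∈ torUSq I ↔
      (wordClass (fun i => u F ^ 2 * AdjoinRoot.of _ (v i)) :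
        AmbientRing (ChainRing F) N (shiftConst α γ)) ∈ I := by
  rw [wordClass_u_sq_mul_of]
  exact mk_mem_torUSq I _

/-- A non-zero word over the chain ring has a multiple that is `u^2` times a non-zero word over
the residue field. -/
theorem exists_mul_eq_u_sq_mul_of {a : Fin N → ChainRing F} (ha : a ≠ 0) :
    ∃ (r : ChainRing F) (v : Fin N → F), v ≠ 0 ∧ ∀ i, r * a i = u F ^ 2 * AdjoinRoot.of _ (v i) := by
  -- The last power of `u` that does not kill the word; it exists because `u^3 = 0`.
  obtain ⟨j, hj, hj'⟩ : ∃ j, (∃ i, u F ^ j * a i ≠ 0) ∧ ∀ i, u F ^ (j + 1) * a i = 0 := by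
    by_contra! hc
    have h : ∀ j, ∃ i, u F ^ j * a i ≠ 0 := by
      intro j
      induction j with
      | zero => simpa using Function.ne_iff.1 ha
      | succ j ih => exact hc j ih
    obtain ⟨i, hi⟩ := h 3
    exact hi (by rw [u_pow_three, zero_mul])
  have h : ∀ i, ∃ x : F, u F ^ j * a i = u F ^ 2 * AdjoinRoot.of _ x := fun i =>
    exists_eq_u_sq_mul_of (by rw [← mul_assoc, ← pow_succ', hj'])
  choose v hv using h
  refine ⟨u F ^ j, v, ?_, hv⟩
  rintro rfl
  obtain ⟨i, hi⟩ := hj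
  exact hi (by simpa using hv i)

theorem codeDist_eq_codeDist_torUSq
    (I : Ideal (AmbientRing (ChainRing F) N (shiftConst α γ))) :
    codeDist I = codeDist (torUSq I) := by
  classical
  have h1 : ∀ v : Fin N → F, v ≠ 0 → wordClass v ∈ torUSq I → codeDist I ≤ hammingNorm v := by
    intro v hv hvI
    refine Nat.sInf_le ⟨fun i => u F ^ 2 * AdjoinRoot.of _ (v i), fun h0 => hv ?_,
      (wordClass_mem_torUSq I v).1 hvI, ?_⟩
    · ext i
      exact u_sq_mul_of_eq_zero.1 (congrFun h0 i)
    · simp only [hammingNorm, ne_eq, u_sq_mul_of_eq_zero]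
  have h2 : ∀ a : Fin N → ChainRing F, a ≠ 0 → wordClass a ∈ I →
      ∃ v : Fin N → F, v ≠ 0 ∧ wordClass v ∈ torUSq I ∧ hammingNorm v ≤ hammingNorm a := by
    intro a ha haI
    obtain ⟨r, v, hv, hrv⟩ := exists_mul_eq_u_sq_mul_of ha
    refine ⟨v, hv, ?_, ?_⟩
    · rw [wordClass_mem_torUSq, ← funext hrv, wordClass_mul]
      exact I.mul_mem_left _ haI
    · refine Finset.card_le_card fun i hi => ?_
      simp only [Finset.mem_filter, Finset.mem_univ, true_and] at hi ⊢
      intro h0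
      have := hrv i
      rw [h0, mul_zero] at this
      exact hi (u_sq_mul_of_eq_zero.1 this.symm)
  by_cases hne : ∃ a : Fin N → ChainRing F, a ≠ 0 ∧ wordClass a ∈ I
  · obtain ⟨a, ha, haI⟩ := hne
    obtain ⟨v, hv, hvI, -⟩ := h2 a ha haI
    apply le_antisymm
    · refine le_csInf ⟨_, v, hv, hvI, rfl⟩ ?_
      rintro _ ⟨w, hw, hwI, rfl⟩
      convert h1 w hw hwI
    · refine le_csInf ⟨_, a, ha, haI, rfl⟩ ?_
      rintro _ ⟨b, hb, hbI, rfl⟩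
      obtain ⟨w, hw, hwI, hle⟩ := h2 b hb hbI
      have hwd : codeDist (torUSq I) ≤ hammingNorm w :=
        Nat.sInf_le ⟨w, hw, hwI, by congr!⟩
      convert hwd.trans hle
  · have e1 : codeDist I = 0 := by
      refine Nat.sInf_eq_zero.2 (Or.inr (Set.eq_empty_of_forall_notMem ?_))
      rintro _ ⟨a, ha, haI, -⟩
      exact hne ⟨a, ha, haI⟩
    rw [e1]
    symm
    refine Nat.sInf_eq_zero.2 (Or.inr (Set.eq_empty_of_forall_notMem ?_))
    rintro _ ⟨v, hv, hvI, -⟩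
    refine hne ⟨_, fun h0 => hv ?_, (wordClass_mem_torUSq I v).1 hvI⟩
    ext i
    exact u_sq_mul_of_eq_zero.1 (congrFun h0 i)

end Torsion

/-! ### Distances of the codes over the field. -/

section FieldCode

variable {F : Type*} [Field F] {p : ℕ} [CharP F p] {n s c : ℕ} {a : F}

theorem mk_mem_span_pow_iff (hp : p.Prime) (hc : c ≤ p ^ s) (f : F[X]) :
    AdjoinRoot.mk (X ^ (n * p ^ s) - C (a ^ p ^ s)) f ∈
      Ideal.span {AdjoinRoot.mk (X ^ (n * p ^ s) - C (a ^ p ^ s)) ((X ^ n - C a) ^ c)} ↔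
    (X ^ n - C a) ^ c ∣ f := by
  have : Fact p.Prime := ⟨hp⟩
  have h : (X ^ (n * p ^ s) - C (a ^ p ^ s) : F[X]) = (X ^ n - C a) ^ p ^ s := by
    rw [sub_pow_char_pow, pow_mul, C_pow]
  rw [Ideal.mem_span_singleton]
  refine ⟨?_, fun hd => map_dvd _ hd⟩
  rintro ⟨q, hq⟩
  obtain ⟨q, rfl⟩ := AdjoinRoot.mk_surjective q
  rw [← map_mul, AdjoinRoot.mk_eq_mk] at hq
  have hd : (X ^ n - C a) ^ c ∣ f - (X ^ n - C a) ^ c * q :=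
    (pow_dvd_pow _ hc).trans (h ▸ hq)
  exact (dvd_sub_left (dvd_mul_right _ _)).1 hd

theorem coeff_X_pow_sub_C_pow_eq_zero (hn : 0 < n) {t M : ℕ} (ht : t < M) (d : ℕ)
    (hd : n * M ≤ d) : ((X ^ n - C a) ^ t).coeff d = 0 := by
  apply coeff_eq_zero_of_natDegree_lt
  rw [natDegree_pow, natDegree_X_pow_sub_C]
  nlinarith

theorem codeDist_span_one (hp : p.Prime) (hn : 0 < n) :
    codeDist (Ideal.span {AdjoinRoot.mk (X ^ (n * p ^ s) - C (a ^ p ^ s))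
      ((X ^ n - C a) ^ 0)}) = 1 := by
  have hpos : 0 < n * p ^ s := Nat.mul_pos hn (pow_pos hp.pos s)
  have hdeg : ∀ d, n * p ^ s ≤ d → (1 : F[X]).coeff d = 0 := fun d hd => by
    rw [coeff_one, if_neg (by omega)]
  have hmem : ∀ f : F[X], AdjoinRoot.mk _ f ∈ Ideal.span
      {AdjoinRoot.mk (X ^ (n * p ^ s) - C (a ^ p ^ s)) ((X ^ n - C a) ^ 0)} := fun f =>
    (mk_mem_span_pow_iff hp (Nat.zero_le _) f).2 (by simp)
  apply le_antisymm
  · refine (codeDist_le_card_support one_ne_zero hdeg (hmem 1)).trans ?_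
    simpa using card_supp_le_succ_natDegree (1 : F[X])
  · refine le_codeDist one_ne_zero hdeg (hmem 1) fun g hg _ _ => ?_
    exact Finset.card_pos.2 (support_nonempty.2 hg)

theorem codeDist_span_pow (hp : p.Prime) (ha : a ≠ 0) (hn : 0 < n) {i j k : ℕ} (hi : i + 1 < p)
    (hs : s = j + (k + 1)) (hc : p ^ j * (i + p * (p ^ k - 1)) + 1 ≤ c)
    (hc' : c ≤ p ^ j * (i + 1 + p * (p ^ k - 1))) :
    codeDist (Ideal.span {AdjoinRoot.mk (X ^ (n * p ^ s) - C (a ^ p ^ s))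
      ((X ^ n - C a) ^ c)}) = (i + 2) * p ^ k := by
  -- The bound `T < p^s` makes `(X^n - a)^T` a genuine word, of degree below `n p^s`.
  have hT : p ^ j * (i + 1 + p * (p ^ k - 1)) < p ^ s := by
    obtain ⟨q, hq⟩ := Nat.exists_eq_add_of_le (Nat.one_le_pow k p hp.pos)
    rw [hs, pow_add, pow_succ']
    refine Nat.mul_lt_mul_of_pos_left ?_ (pow_pos hp.pos j)
    rw [hq, Nat.add_sub_cancel_left, mul_add]
    omega
  have hmem := fun f => mk_mem_span_pow_iff (n := n) (a := a) hp (hc'.trans hT.le) f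
  have hne : ∀ t, (X ^ n - C a : F[X]) ^ t ≠ 0 := fun t =>
    pow_ne_zero _ (X_pow_sub_C_ne_zero hn a)
  have hdeg := coeff_X_pow_sub_C_pow_eq_zero (a := a) hn hT
  have hcw := (hmem ((X ^ n - C a) ^ (p ^ j * (i + 1 + p * (p ^ k - 1))))).2 (pow_dvd_pow _ hc')
  apply le_antisymm
  · exact (codeDist_le_card_support (hne _) hdeg hcw).trans (card_support_pow_le hp a hn _ _ _)
  · refine le_codeDist (hne _) hdeg hcw fun g hg hgdeg hgI => ?_
    obtain ⟨t, hct, hts, ht⟩ := exists_digitProd_le_card_support hp ha hn hg hgdeg ((hmem g).1 hgI)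
    refine (le_digitProd hp.two_le hi (hc.trans hct) ?_).trans ht
    rwa [← pow_add, ← hs]

end FieldCode

end Constacyclic

theorem mainTheorem4 {F : Type*} [Field F] [Finite F] (p m n s : ℕ) (hp : p.Prime)
    (hm : 0 < m) (hn : 0 < n) (hs : 0 < s) (hF : Nat.card F = p ^ m)
    (α₀ : F) (hα₀ : α₀ ≠ 0) (hirr : Irreducible (X ^ n - C α₀ : F[X]))
    (α γ : F) (hα : α = α₀ ^ p ^ s)
    (I : Ideal (Constacyclic.AmbientRing (Constacyclic.ChainRing F) (n * p ^ s)
      (Constacyclic.shiftConst α γ)))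
    (hbot : I ≠ ⊥) (htop : I ≠ ⊤)
    (c : ℕ) (hc : c < p ^ s)
    (htor : Constacyclic.torUSq I =
      Ideal.span {AdjoinRoot.mk (X ^ (n * p ^ s) - C α : F[X]) ((X ^ n - C α₀) ^ c)}) :
    Constacyclic.codeDist I = Constacyclic.codeDist (Constacyclic.torUSq I) ∧
    (c = 0 → Constacyclic.codeDist I = 1) ∧
    (∀ l : ℕ, l ≤ p - 2 → l * p ^ (s - 1) + 1 ≤ c → c ≤ (l + 1) * p ^ (s - 1) →
      Constacyclic.codeDist I = l + 2) ∧
    (∀ i k : ℕ, 1 ≤ i → i ≤ p - 1 → 1 ≤ k → k ≤ s - 1 →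
      p ^ s - p ^ (s - k) + (i - 1) * p ^ (s - k - 1) + 1 ≤ c →
      c ≤ p ^ s - p ^ (s - k) + i * p ^ (s - k - 1) →
      Constacyclic.codeDist I = (i + 1) * p ^ k) := by
  have : Fact p.Prime := ⟨hp⟩
  have : CharP F p := by
    obtain ⟨q, hq⟩ := CharP.exists F
    have := Fintype.ofFinite F
    obtain ⟨e, hqp, he⟩ := FiniteField.card F q
    rw [← Nat.card_eq_fintype_card, hF] at he
    have hdvd : p ∣ q := hp.dvd_of_dvd_pow (he ▸ dvd_pow_self p hm.ne')
    rwa [(Nat.prime_dvd_prime_iff_eq hp hqp).1 hdvd]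
  subst hα
  rw [Constacyclic.codeDist_eq_codeDist_torUSq, htor]
  refine ⟨rfl, ?_, ?_, ?_⟩
  · rintro rfl
    exact Constacyclic.codeDist_span_one hp hn
  · intro l hl hc1 hc2
    have := hp.two_le
    -- The middle case is `k = 0`: a single leading digit.
    rw [Constacyclic.codeDist_span_pow (j := s - 1) (k := 0) (i := l) hp hα₀ hn (by omega)
      (by omega)]
    · simp
    · simpa [mul_comm] using hc1
    · simpa [mul_comm] using hc2
  · intro i k hi1 hi2 hk1 hk2 hc1 hc2
    -- Shifting `i` by one matches the interval and the value `(i + 2) p^k` of `codeDist_span_pow`.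
    obtain ⟨i, rfl⟩ := Nat.exists_eq_add_of_le' hi1
    obtain ⟨j, rfl⟩ : ∃ j, s = j + (k + 1) := ⟨s - (k + 1), by omega⟩
    have e1 : j + (k + 1) - k = j + 1 := by omega
    have e2 : j + 1 - 1 = j := rfl
    have e3 : p ^ (j + (k + 1)) - p ^ (j + 1) = p ^ j * (p * (p ^ k - 1)) := by
      rw [Nat.mul_sub, Nat.mul_sub, mul_one]
      congr 1
      ring
    rw [e1, e2, e3] at hc1 hc2
    rw [Constacyclic.codeDist_span_pow (j := j) (k := k) (i := i) hp hα₀ hn (by omega) rfl]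
    · refine le_trans (le_of_eq ?_) hc1
      rw [Nat.add_sub_cancel]
      ring
    · refine hc2.trans (le_of_eq ?_)
      ring
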